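/- **Setting.** Let $Y=(0,\ell_1)\times\cdots\times(0,\ell_d)$ with $\ell_i>0$, and let $a:\mathbb R^d\to\mathbb R^{d\times d}$ be measurable, $Y$-periodic, symmetric, with $\lambda|\xi|^2\le a(y)\xi\cdot\xi\le\Lambda|\xi|^2$ for all $\xi\in\mathbb R^d$ and a.e. $y\in Y$, for some $\lambda,\Lambda>0$. Write $(\cdot,\cdot)_Y$ for the $L^2(Y)$ inner product, $\langle v\rangle_Y=\frac1{|Y|}\int_Y v$, and let $W_{\rm per}(Y)$ be the space of zero-mean functions of $H^1_{\rm per}(Y)$, the $H^1(Y)$-closure of the smooth $Y$-periodic functions. For a tensor $q$ of order $n$ on $\mathbb R^d$, let $S^n(q)_{i_1\cdots i_n}=\frac1{n!}\sum_{\sigma\in\mathbb S_n}q_{i_{\sigma(1)}\cdots i_{\sigma(n)}}$; for tensors of the same order $n$, write $p=_Sq$ if $S^n(p)=S^n(q)$. Let $r\ge1$ and let $a^{2s}$ and $b^{2s}$ ($1\le s\le r-1$) be tensors of order $2s+2$ and $2s$. Let $\chi^0=1$ and let $\chi^k=(\chi^k_{i_1\cdots i_k})$, $1\le k\le 2r+1$,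 be the zero-mean correctors, i.e. functions in $W_{\rm per}(Y)$ such that, for all $w\in W_{\rm per}(Y)$, $(a\nabla\chi^1_i,\nabla w)_Y=-(ae_i,\nabla w)_Y$ and, for $1\le k\le 2r$, $$(a\nabla\chi^{k+1}_{i_1\cdots i_{k+1}},\nabla w)_Y=S^{k+1}_{i_1\cdots i_{k+1}}\Big\{-(ae_{i_1}\chi^k_{i_2\cdots i_{k+1}},\nabla w)_Y+(a(\nabla\chi^k_{i_2\cdots i_{k+1}}+e_{i_2}\chi^{k-1}_{i_3\cdots i_{k+1}}),e_{i_1}w)_Y-\sum_{j=0}^{k-1}((p^{k-1-j}\otimes\chi^j)_{i_1\cdots i_{k+1}},w)_Y\Big\},$$ where $p^{2s}=(-1)^sc^s$, $p^{2s+1}=0$, $c^0=g^0$ (the homogenized tensor), $c^s=a^{2s}-\sum_{m=0}^{s-1}c^m\otimes b^{2(s-m)}$, and, for $s\ge0$, $$g^{2s}_{i_1\cdots i_{2s+2}}=\frac1{|Y|}\big(a(\nabla\chi^{2s+1}_{i_2\cdots i_{2s+2}}+e_{i_2}\chi^{2s}_{i_3\cdots i_{2s+2}}),e_{i_1}\big)_Y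 .$$ Assume that the effective tensors satisfy the solvability constraints $p^{2s}=_Sg^{2s}$ for $1\le s\le r-1$. **Theorem.** One has $g^{2r}=_S(-1)^rk^r+h^r$, where $$k^r_{i_1\cdots i_{2r+2}}=-\big\langle a\nabla\chi^{r+1}_{i_1\cdots i_{r+1}}\cdot\nabla\chi^{r+1}_{i_{r+2}\cdots i_{2r+2}}\big\rangle_Y+\big\langle ae_{i_2}\chi^r_{i_3\cdots i_{r+2}}\cdot e_{i_1}\chi^r_{i_{r+3}\cdots i_{2r+2}}\big\rangle_Y,$$ $$h^r=\sum_{j=1}^{\lceil r/2\rceil}\sum_{l=1}^{\lceil r/2\rceil}\big\langle g^{2(r-j-l+1)}\otimes\chi^{2j-1}\otimes\chi^{2l-1}\big\rangle_Y-\sum_{j=1}^{\lfloor r/2\rfloor}\sum_{l=1}^{\lfloor r/2\rfloor}\big\langle g^{2(r-j-l)}\otimes\chi^{2j}\otimes\chi^{2l}\big\rangle_Y$$ (the second double sum is empty for $r=1$). Here $k^r$ is built from $\chi^r,\chi^{r+1}$ only, and $h^r$ from $g^0,g^2,\dots,g^{2(r-1)}$ and $\chi^1,\dots,\chi^r$ only.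 Consequently, up to symmetrization $h^r$ can be computed from $\chi^1,\dots,\chi^r$, and $g^{2r}$ from $\chi^1,\dots,\chi^{r+1}$: define recursively, for $s\ge 0$, $G^s=(-1)^sk^s+h^s[G^0,\dots,G^{s-1}]$, where $k^s$ is given by the formula above with $s$ in place of $r$ and where $h^s[G^0,\dots,G^{s-1}]$ is the formula for $h^s$ with each $g^{2m}$ replaced by $G^m$ (so $G^0=k^0$). Then $G^s$ is an expression in $\chi^1,\dots,\chi^{s+1}$ only (with $\chi^0=1$), $h^r=_Sh^r[G^0,\dots,G^{r-1}]$, which is an expression in $\chi^1,\dots,\chi^r$ only, and $S^{2r+2}(g^{2r})=S^{2r+2}(G^r)$. -/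

import Mathlib

open MeasureTheory
open scoped Matrix ContDiff

namespace HighOrderWave

noncomputable section

/-! ### Tensors of order `n` over `ℝ^d` -/

/-- Tensors of order `n` on `ℝ^d`, given by their components `q_{i_1 ⋯ i_n}`. -/
abbrev Ten (d n : ℕ) : Type := (Fin n → Fin d) → ℝ

/-- The symmetrization operator `S^n`. -/
def symmetrize {d n : ℕ} (q : Ten d n) : Ten d n := fun i =>
  (1 / (n.factorial : ℝ)) * ∑ σ : Equiv.Perm (Fin n), q (fun t => i (σ t))

/-- `p =_S q`: equality up to symmetrization. -/
def SymEq {d n : ℕ} (p q : Ten d n) : Prop := symmetrize p = symmetrize q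

/-- The tensor product `(p ⊗ q)_{i_1 ⋯ i_{m+n}} = p_{i_1 ⋯ i_m} q_{i_{m+1} ⋯ i_{m+n}}`. -/
def tmul {d m n : ℕ} (p : Ten d m) (q : Ten d n) : Ten d (m + n) := fun i =>
  p (fun t => i (Fin.castAdd n t)) * q (fun t => i (Fin.natAdd m t))

/-- A tensor of order `m` seen as a tensor of order `n`, when `m = n`. -/
def castTen {d m n : ℕ} (h : m = n) (q : Ten d m) : Ten d n := fun i =>
  q (fun t => i (Fin.cast h t))

/-- The `n` consecutive indices `i_{s+1}, …, i_{s+n}` of a multi-index `i`. -/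
def block {d N : ℕ} (i : Fin N → Fin d) (s n : ℕ) (h : s + n ≤ N) : Fin n → Fin d := fun t =>
  i ⟨s + t, by have := t.isLt; omega⟩

/-- The `j`-th vector of the canonical basis of `ℝ^d`. -/
def basisVec {d : ℕ} (j : Fin d) : Fin d → ℝ := Pi.single j 1

/-! ### The reference cell, the coefficient and the periodic Sobolev space -/

/-- The reference cell `Y = (0, ℓ_1) × ⋯ × (0, ℓ_d)`. -/
def cell {d : ℕ} (ℓ : Fin d → ℝ) : Set (Fin d → ℝ) := Set.univ.pi fun i => Set.Ioo 0 (ℓ i)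

/-- `Y`-periodic functions on `ℝ^d`. -/
def CellPeriodic {d : ℕ} {X : Type*} (ℓ : Fin d → ℝ) (f : (Fin d → ℝ) → X) : Prop :=
  ∀ (y : Fin d → ℝ) (i : Fin d), f (y + Pi.single i (ℓ i)) = f y

/-- The coefficient `a`: a measurable, `Y`-periodic, symmetric, uniformly elliptic and bounded
`d × d` matrix field. -/
structure IsCoefficient {d : ℕ} (ℓ : Fin d → ℝ)
    (a : (Fin d → ℝ) → Matrix (Fin d) (Fin d) ℝ) : Prop where
  aemeasurable : ∀ i j, AEMeasurable (fun y => a y i j) (volume.restrict (cell ℓ))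
  periodic : CellPeriodic ℓ a
  isSymm : ∀ᵐ y ∂(volume.restrict (cell ℓ)), (a y).IsSymm
  elliptic : ∃ lam > (0 : ℝ), ∃ Lam > (0 : ℝ), ∀ᵐ y ∂(volume.restrict (cell ℓ)),
    ∀ ξ : Fin d → ℝ, lam * (ξ ⬝ᵥ ξ) ≤ (a y *ᵥ ξ) ⬝ᵥ ξ ∧ (a y *ᵥ ξ) ⬝ᵥ ξ ≤ Lam * (ξ ⬝ᵥ ξ)

/-- An element of `H¹_per(Y)`, the closure of the smooth `Y`-periodic functions for the `H¹(Y)`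
norm: a function `u ∈ L²(Y)` together with its gradient `∇u ∈ L²(Y)^d`, such that some smooth
`Y`-periodic functions `φ` converge to `u` in `L²(Y)` while their gradients converge to `∇u` in
`L²(Y)^d`. (This determines `∇u` almost everywhere in `Y`.) -/
structure PerH1 {d : ℕ} (ℓ : Fin d → ℝ) where
  toFun : (Fin d → ℝ) → ℝ
  grad : (Fin d → ℝ) → (Fin d → ℝ)
  memLp : MemLp toFun 2 (volume.restrict (cell ℓ))
  grad_memLp : ∀ i, MemLp (fun y => grad y i) 2 (volume.restrict (cell ℓ))
  approx : ∀ ε : ENNReal, 0 < ε → ∃ φ : (Fin d → ℝ) → ℝ,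
    ContDiff ℝ ∞ φ ∧ CellPeriodic ℓ φ ∧
    eLpNorm (fun y => φ y - toFun y) 2 (volume.restrict (cell ℓ)) < ε ∧
    ∀ i, eLpNorm (fun y => fderiv ℝ φ y (basisVec i) - grad y i) 2
      (volume.restrict (cell ℓ)) < ε

/-- The constant function `1` as an element of `H¹_per(Y)`. -/
def PerH1.one {d : ℕ} (ℓ : Fin d → ℝ) : PerH1 ℓ where
  toFun := fun _ => 1
  grad := fun _ => 0
  memLp := by
    have : IsFiniteMeasure (volume.restrict (cell ℓ)) := by
      refine ⟨?_⟩
      rw [Measure.restrict_apply_univ]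
      unfold cell
      rw [volume_pi_pi]
      exact ENNReal.prod_lt_top fun i _ => by simp [Real.volume_Ioo]
    exact memLp_const 1
  grad_memLp := fun i => by
    simp
  approx := fun ε hε => ⟨fun _ => 1, contDiff_const, fun _ _ => rfl, by simpa using hε,
    fun i => by simpa using hε⟩

/-- `u` has zero mean over `Y`. The zero-mean elements of `H¹_per(Y)` form the space `W_per(Y)`. -/
def PerH1.ZeroMean {d : ℕ} {ℓ : Fin d → ℝ} (u : PerH1 ℓ) : Prop :=
  ∫ y in cell ℓ, u.toFun y = 0

/-- A family of tensor functions `χ^k`, `k = 0, 1, 2, …`: the components `χ^k_{i_1 ⋯ i_k}` are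
elements of `H¹_per(Y)`. -/
abbrev TensorFamily {d : ℕ} (ℓ : Fin d → ℝ) : Type :=
  (k : ℕ) → (Fin k → Fin d) → PerH1 ℓ

/-- The value `χ^k(y)`, a tensor of order `k`. -/
def TensorFamily.val {d : ℕ} {ℓ : Fin d → ℝ} (χ : TensorFamily ℓ) (k : ℕ) (y : Fin d → ℝ) :
    Ten d k := fun i => (χ k i).toFun y

/-! ### Effective tensors and correctors -/

/-- The tensor `g^m`, of order `m + 2`:
`g^m_{i_1 ⋯ i_{m+2}} = |Y|⁻¹ ∫_Y a (∇χ^{m+1}_{i_2 ⋯ i_{m+2}} + e_{i_2} χ^m_{i_3 ⋯ i_{m+2}}) · e_{i_1}`.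
For `m = 0` (where `χ^0 = 1`) this is the homogenized tensor `a^0`. -/
def gTensor {d : ℕ} {ℓ : Fin d → ℝ} (a : (Fin d → ℝ) → Matrix (Fin d) (Fin d) ℝ)
    (χ : TensorFamily ℓ) (m : ℕ) : Ten d (m + 2) := fun i =>
  ⨍ y in cell ℓ,
    (a y *ᵥ ((χ (m + 1) (Fin.tail i)).grad y
      + (χ m (Fin.tail (Fin.tail i))).toFun y • basisVec (i 1))) ⬝ᵥ basisVec (i 0)

/-- The tensors `c^r`: `c^0 = a^0` and `c^r = a^{2r} - ∑_{l=0}^{r-1} c^l ⊗ b^{2(r-l)}`, where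
`aT r = a^{2r}` and `bT r = b^{2r}`. -/
def cTensor {d : ℕ} (a0 : Ten d 2) (aT : (r : ℕ) → Ten d (2 * r + 2))
    (bT : (r : ℕ) → Ten d (2 * r)) : (r : ℕ) → Ten d (2 * r + 2)
  | 0 => a0
  | r + 1 => aT (r + 1) - ∑ l : Fin (r + 1),
      castTen (by have := l.isLt; omega) (tmul (cTensor a0 aT bT l) (bT (r + 1 - l)))
  termination_by r => r
  decreasing_by exact l.isLt

/-- The tensors `p^{2r} = (-1)^r c^r` and `p^{2r+1} = 0`; `p^k` has order `k + 2`. -/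
def pTensor {d : ℕ} (a0 : Ten d 2) (aT : (r : ℕ) → Ten d (2 * r + 2))
    (bT : (r : ℕ) → Ten d (2 * r)) (k : ℕ) : Ten d (k + 2) :=
  if h : 2 * (k / 2) = k then
    castTen (by omega) ((-1 : ℝ) ^ (k / 2) • cTensor a0 aT bT (k / 2))
  else 0

/-- The bilinear form `(a ∇u, ∇w)_Y`. -/
def energy {d : ℕ} {ℓ : Fin d → ℝ} (a : (Fin d → ℝ) → Matrix (Fin d) (Fin d) ℝ)
    (u w : PerH1 ℓ) : ℝ :=
  ∫ y in cell ℓ, (a y *ᵥ u.grad y) ⬝ᵥ w.grad y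

/-- The right-hand side, before symmetrization, of the cell problem for `χ^{k+1}` with `k = m + 1`,
evaluated at the test function `w`:
`-(a e_{i_1} χ^k_{i_2 ⋯ i_{k+1}}, ∇w)_Y
  + (a (∇χ^k_{i_2 ⋯ i_{k+1}} + e_{i_2} χ^{k-1}_{i_3 ⋯ i_{k+1}}), e_{i_1} w)_Y
  - ∑_{j=0}^{k-1} ((p^{k-1-j} ⊗ χ^j)_{i_1 ⋯ i_{k+1}}, w)_Y`. -/
def cellRhs {d : ℕ} {ℓ : Fin d → ℝ} (a : (Fin d → ℝ) → Matrix (Fin d) (Fin d) ℝ)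
    (p : (k : ℕ) → Ten d (k + 2)) (χ : TensorFamily ℓ) (m : ℕ) (w : PerH1 ℓ) :
    Ten d (m + 2) := fun i =>
  - (∫ y in cell ℓ,
      (a y *ᵥ ((χ (m + 1) (Fin.tail i)).toFun y • basisVec (i 0))) ⬝ᵥ w.grad y)
  + (∫ y in cell ℓ,
      (a y *ᵥ ((χ (m + 1) (Fin.tail i)).grad y
        + (χ m (Fin.tail (Fin.tail i))).toFun y • basisVec (i 1))) ⬝ᵥ
        (w.toFun y • basisVec (i 0)))
  - ∑ j : Fin (m + 1), ∫ y in cell ℓ,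
      castTen (n := m + 2) (by have := j.isLt; omega) (tmul (p (m - j)) (χ.val j y)) i
        * w.toFun y

/-- `χ^1, …, χ^n` are the zero-mean correctors associated with the coefficient `a` and the tensors
`p^k`: they belong to `W_per(Y)` and solve the cell problems, with test functions in `W_per(Y)`.
The family is completed by `χ^0 = 1`; nothing is required of `χ^k` for `k > n`. -/
structure IsCorrectors {d : ℕ} {ℓ : Fin d → ℝ} (a : (Fin d → ℝ) → Matrix (Fin d) (Fin d) ℝ)
    (p : (k : ℕ) → Ten d (k + 2)) (χ : TensorFamily ℓ) (n : ℕ) : Prop where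
  zero : χ 0 = fun _ => PerH1.one ℓ
  zeroMean : ∀ k, 1 ≤ k → k ≤ n → ∀ i, (χ k i).ZeroMean
  first : 1 ≤ n → ∀ (i : Fin 1 → Fin d) (w : PerH1 ℓ), w.ZeroMean →
    energy a (χ 1 i) w = - ∫ y in cell ℓ, (a y *ᵥ basisVec (i 0)) ⬝ᵥ w.grad y
  next : ∀ m, m + 2 ≤ n → ∀ (i : Fin (m + 2) → Fin d) (w : PerH1 ℓ), w.ZeroMean →
    energy a (χ (m + 2) i) w = symmetrize (cellRhs a p χ m w) i

/-! ### The tensors of the decomposition -/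

/-- The tensor `k^r`, of order `2r + 2`:
`k^r_{i_1 ⋯ i_{2r+2}} = -⟨a ∇χ^{r+1}_{i_1 ⋯ i_{r+1}} · ∇χ^{r+1}_{i_{r+2} ⋯ i_{2r+2}}⟩_Y
  + ⟨a e_{i_2} χ^r_{i_3 ⋯ i_{r+2}} · e_{i_1} χ^r_{i_{r+3} ⋯ i_{2r+2}}⟩_Y`. -/
def kTensor {d : ℕ} {ℓ : Fin d → ℝ} (a : (Fin d → ℝ) → Matrix (Fin d) (Fin d) ℝ)
    (χ : TensorFamily ℓ) (r : ℕ) : Ten d (2 * r + 2) := fun i =>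
  - (⨍ y in cell ℓ,
      (a y *ᵥ (χ (r + 1) (block i 0 (r + 1) (by omega))).grad y) ⬝ᵥ
        (χ (r + 1) (block i (r + 1) (r + 1) (by omega))).grad y)
  + ⨍ y in cell ℓ,
      (a y *ᵥ ((χ r (block i 2 r (by omega))).toFun y • basisVec (i ⟨1, by omega⟩))) ⬝ᵥ
        ((χ r (block i (r + 2) r (by omega))).toFun y • basisVec (i ⟨0, by omega⟩))

/-- The mean `⟨q ⊗ χ^j ⊗ χ^l⟩_Y` of a tensor-valued function, for a constant tensor `q`. -/
def meanTriple {d n : ℕ} {ℓ : Fin d → ℝ} (q : Ten d n) (χ : TensorFamily ℓ) (j l : ℕ) :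
    Ten d (n + j + l) := fun i =>
  ⨍ y in cell ℓ, tmul (tmul q (χ.val j y)) (χ.val l y) i

/-- The tensor `h^r`, of order `2r + 2`, built from a family of tensors `G s` of order `2s + 2` (to
be taken as `g^{2s}`) and from `χ`:
`∑_{j,l=1}^{⌈r/2⌉} ⟨G (r-j-l+1) ⊗ χ^{2j-1} ⊗ χ^{2l-1}⟩_Y
  - ∑_{j,l=1}^{⌊r/2⌋} ⟨G (r-j-l) ⊗ χ^{2j} ⊗ χ^{2l}⟩_Y`.
The summation variables of the code are `j - 1` and `l - 1`, and `⌈r/2⌉ = (r + 1) / 2`; no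
subtraction below is truncated. -/
def hTensor {d : ℕ} {ℓ : Fin d → ℝ} (G : (s : ℕ) → Ten d (2 * s + 2)) (χ : TensorFamily ℓ)
    (r : ℕ) : Ten d (2 * r + 2) :=
  (∑ j : Fin ((r + 1) / 2), ∑ l : Fin ((r + 1) / 2),
    castTen (by have := j.isLt; have := l.isLt; omega)
      (meanTriple (G (r + 1 - (j + 1) - (l + 1))) χ (2 * (j + 1) - 1) (2 * (l + 1) - 1)))
  - ∑ j : Fin (r / 2), ∑ l : Fin (r / 2),
    castTen (by have := j.isLt; have := l.isLt; omega)
      (meanTriple (G (r - (j + 1) - (l + 1))) χ (2 * (j + 1)) (2 * (l + 1)))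

/-- The tensors obtained by applying the decomposition recursively, starting from `k^0`:
`G^r = (-1)^r k^r + h^r`, where `h^r` is built from the previously computed `G^0, …, G^{r-1}` in
place of `g^0, …, g^{2(r-1)}`. -/
def reducedTensor {d : ℕ} {ℓ : Fin d → ℝ} (a : (Fin d → ℝ) → Matrix (Fin d) (Fin d) ℝ)
    (χ : TensorFamily ℓ) (r : ℕ) : Ten d (2 * r + 2) :=
  (-1 : ℝ) ^ r • kTensor a χ r
    + hTensor (fun s => if s < r then reducedTensor a χ s else 0) χ r
  termination_by r

end

end HighOrderWave

open HighOrderWave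

/-! Two tensors agree up to symmetrization iff their full contractions with ξ, …, ξ agree for every
ξ (`symEq_iff_contract`). Contraction turns ⊗ into a product and absorbs the symmetrizer of the cell
problems. The decomposition thus becomes a scalar identity for the contracted correctors u_k and
gradients U_k (`effective_decomposition`).

That identity rests on the symmetry of A = ⟨a · , ·⟩. Put s_0 = 0, s_m = U_m + ξ u_{m-1} and b_m =
A(s_m, ξ u_{2r+1-m}). The equation for χ^{m+1} tested with χ^{2r+1-m} expresses A(s_{m+1},
s_{2r+1-m}) as b_m + b_{m+1} minus a sum of terms Q j n = p^{2r-j-n} ⟨u_j u_n⟩. Exchanging m with 2r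
- m leaves the left side unchanged, so c_i = b_{2r+1-i} - b_i satisfies c_{i+1} + c_i = (terms in
Q). Here c_0 is g^{2r}, while c_r involves only χ^r and χ^{r+1}, up to terms in Q; r steps of the
recurrence give the sign (-1)^r.

The Q-terms collapse to the square 1 ≤ j, n ≤ r (`sum_triangle_sub_sum_triangle`): Q is symmetric,
vanishes for j + n odd since odd p vanish, and for j = 0 since correctors have zero mean. Its
odd-odd and even-even parts are the two sums of h^r. Only p^{2s} with s < r occur, and there p may
be replaced by g.

Finally, the contraction of h^r sees only the contractions of its tensor arguments, so replacing
g^{2s} by G^s is an induction. -/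

namespace HighOrderWave


/-! ### Contraction with a direction and polarization -/

/-- The full contraction `∑_i ξ_{i_1} ⋯ ξ_{i_n} f_{i_1 ⋯ i_n}` of a tensor with values in a vector
space with the direction `ξ`. -/
def contract {d n : ℕ} {M : Type*} [AddCommGroup M] [Module ℝ M] (ξ : Fin d → ℝ)
    (f : (Fin n → Fin d) → M) : M := ∑ i, (∏ t, ξ (i t)) • f i

section contract

variable {d : ℕ} {M N K : Type*} [AddCommGroup M] [Module ℝ M] [AddCommGroup N] [Module ℝ N]
  [AddCommGroup K] [Module ℝ K] (ξ : Fin d → ℝ)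

theorem contract_add {n : ℕ} (f g : (Fin n → Fin d) → M) :
    contract ξ (fun i => f i + g i) = contract ξ f + contract ξ g := by
  simp [contract, Finset.sum_add_distrib]

theorem contract_sub {n : ℕ} (f g : (Fin n → Fin d) → M) :
    contract ξ (fun i => f i - g i) = contract ξ f - contract ξ g := by
  simp [contract, smul_sub, Finset.sum_sub_distrib]

theorem contract_sum {n : ℕ} {ι : Type*} (s : Finset ι) (f : ι → (Fin n → Fin d) → M) :
    contract ξ (fun i => ∑ k ∈ s, f k i) = ∑ k ∈ s, contract ξ (f k) := by
  simp only [contract, Finset.smul_sum]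
  exact Finset.sum_comm

theorem contract_finsetSum {n : ℕ} {ι : Type*} (s : Finset ι) (f : ι → (Fin n → Fin d) → M) :
    contract ξ (∑ k ∈ s, f k) = ∑ k ∈ s, contract ξ (f k) := by
  rw [← contract_sum]
  congr 1
  ext i
  simp

theorem map_contract {n : ℕ} (L : M →ₗ[ℝ] N) (f : (Fin n → Fin d) → M) :
    contract ξ (fun i => L (f i)) = L (contract ξ f) := by
  simp [contract]

theorem contract_neg {n : ℕ} (f : (Fin n → Fin d) → M) :
    contract ξ (fun i => - f i) = - contract ξ f := by
  simp [contract]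

theorem contract_smul {n : ℕ} (c : ℝ) (f : (Fin n → Fin d) → M) :
    contract ξ (fun i => c • f i) = c • contract ξ f := by
  simp only [contract, Finset.smul_sum]
  exact Finset.sum_congr rfl fun i _ => smul_comm _ _ _

theorem contract_zero_order (f : (Fin 0 → Fin d) → M) : contract ξ f = f default := by
  simp [contract]

theorem contract_castTen {m n : ℕ} (h : m = n) (q : Ten d m) :
    contract ξ (castTen h q) = contract ξ q := by
  subst h
  rfl

/-- The weight ∏ ξ factors over the two index blocks. A general bilinear map B covers tensor
products and integral forms alike. -/
theorem contract_append {m n : ℕ} (B : M →ₗ[ℝ] N →ₗ[ℝ] K) (f : (Fin m → Fin d) → M)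
    (g : (Fin n → Fin d) → N) :
    contract ξ (fun i : Fin (m + n) → Fin d =>
      B (f fun t => i (Fin.castAdd n t)) (g fun t => i (Fin.natAdd m t))) =
      B (contract ξ f) (contract ξ g) := by
  simp only [contract, map_sum, map_smul, LinearMap.sum_apply, LinearMap.smul_apply]
  rw [← (Fin.appendEquiv m n).sum_comp, Fintype.sum_prod_type]
  simp only [Finset.smul_sum, smul_smul]
  rw [Finset.sum_comm]
  refine Finset.sum_congr rfl fun i _ => Finset.sum_congr rfl fun j _ => ?_
  simp [Fin.prod_univ_add, mul_comm]

theorem contract_block {m n k : ℕ} (h : m + n = k) (B : M →ₗ[ℝ] N →ₗ[ℝ] K)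
    (f : (Fin m → Fin d) → M) (g : (Fin n → Fin d) → N) :
    contract ξ (fun i : Fin k → Fin d =>
      B (f (block i 0 m (by omega))) (g (block i m n (by omega)))) =
      B (contract ξ f) (contract ξ g) := by
  subst h
  rw [← contract_append]
  congr 1
  ext i
  congr 2
  · congr 1
    ext t
    simp [block, Fin.castAdd, Fin.castLE]

theorem contract_succ {n : ℕ} (f : (Fin (n + 1) → Fin d) → M) :
    contract ξ f = ∑ j, ξ j • contract ξ fun i => f (Fin.cons j i) := by
  simp only [contract]
  rw [← (Fin.consEquiv fun _ : Fin (n + 1) => Fin d).sum_comp, Fintype.sum_prod_type]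
  simp [Fin.consEquiv, Fin.prod_univ_succ, Finset.smul_sum, smul_smul]

theorem sum_smul_basisVec : ∑ j, ξ j • (basisVec j : Fin d → ℝ) = ξ := by
  ext k
  simp [basisVec, Pi.single_apply]

theorem map_eq_sum_basisVec (B : (Fin d → ℝ) →ₗ[ℝ] M) : B ξ = ∑ j, ξ j • B (basisVec j) := by
  conv_lhs => rw [← sum_smul_basisVec ξ]
  simp

/-- By linearity the basis vectors e_{i_1} of the cell problems sum up to ξ. -/
theorem contract_tail {n : ℕ} (B : (Fin d → ℝ) →ₗ[ℝ] M →ₗ[ℝ] N) (f : (Fin n → Fin d) → M) :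
    contract ξ (fun i : Fin (n + 1) → Fin d => B (basisVec (i 0)) (f (Fin.tail i))) =
      B ξ (contract ξ f) := by
  rw [contract_succ]
  simp [map_contract, map_eq_sum_basisVec ξ B]

/-- The weight ∏ ξ does not depend on the order of the indices. -/
theorem contract_comp_perm {n : ℕ} (q : (Fin n → Fin d) → M) (σ : Equiv.Perm (Fin n)) :
    contract ξ (fun i => q fun t => i (σ t)) = contract ξ q := by
  simp only [contract]
  refine Fintype.sum_equiv (Equiv.arrowCongr σ.symm (Equiv.refl _)) _ _ fun i => ?_
  congr 1
  exact (Equiv.prod_comp σ fun t => ξ (i t)).symm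

theorem contract_symmetrize {n : ℕ} (q : Ten d n) :
    contract ξ (symmetrize q) = contract ξ q := by
  unfold symmetrize
  simp only [← smul_eq_mul (a := 1 / (n.factorial : ℝ))]
  rw [contract_smul, contract_sum]
  simp only [contract_comp_perm]
  rw [Finset.sum_const, Finset.card_univ, Fintype.card_perm, Fintype.card_fin,
    ← Nat.cast_smul_eq_nsmul ℝ, smul_smul, one_div_mul_cancel (by positivity), one_smul]

end contract

theorem continuous_contract_multilinear {d n : ℕ} (q : Ten d n) :
    ∃ f : ContinuousMultilinearMap ℝ (fun _ : Fin n => Fin d → ℝ) ℝ,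
      ∀ v, f v = ∑ i : Fin n → Fin d, (∏ t, v t (i t)) * q i := by
  refine ⟨∑ i : Fin n → Fin d, q i •
    (ContinuousMultilinearMap.mkPiAlgebra ℝ (Fin n) ℝ).compContinuousLinearMap
      fun t => ContinuousLinearMap.proj (i t), fun v => ?_⟩
  simp [mul_comm]

/-- Polarization: a tensor is determined up to symmetrization by its contractions. -/
theorem symEq_iff_contract {d n : ℕ} {p q : Ten d n} :
    SymEq p q ↔ ∀ ξ : Fin d → ℝ, contract ξ p = contract ξ q := by
  constructor
  · intro h ξ
    rw [← contract_symmetrize, h, contract_symmetrize]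
  · intro h
    obtain ⟨f, hf⟩ := continuous_contract_multilinear p
    obtain ⟨g, hg⟩ := continuous_contract_multilinear q
    have hfg : (fun ξ : Fin d → ℝ => f fun _ => ξ) = fun ξ => g fun _ => ξ := by
      ext ξ
      simpa [hf, hg, contract] using h ξ
    have heval : ∀ (q : Ten d n) (i : Fin n → Fin d) (σ : Equiv.Perm (Fin n)),
        ∑ j : Fin n → Fin d, (∏ t, (basisVec (i (σ t)) : Fin d → ℝ) (j t)) * q j =
          q fun t => i (σ t) := by
      intro q i σ
      rw [Finset.sum_eq_single fun t => i (σ t)]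
      · simp [basisVec]
      · intro j _ hj
        obtain ⟨t, ht⟩ := Function.ne_iff.mp hj
        rw [Finset.prod_eq_zero (Finset.mem_univ t), zero_mul]
        simp [basisVec, ht]
      · simp
    ext i
    unfold symmetrize
    congr 1
    -- The n-th derivative at 0 of ξ ↦ f(ξ, …, ξ) is the sum of f over all permutations of its
    -- arguments; on basis vectors this is n! times a component of the symmetrization.
    have h1 := f.iteratedFDeriv_comp_diagonal 0 fun t => basisVec (i t)
    have h2 := g.iteratedFDeriv_comp_diagonal 0 fun t => basisVec (i t)
    rw [hfg, h2] at h1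
    simp only [hf, hg, heval] at h1
    exact h1.symm


/-! ### Alternating sums and the abstract scalar identity -/

theorem eq_sum_alternating_add {c D : ℕ → ℝ} {N : ℕ} (h : ∀ i < N, c (i + 1) + c i = D i) :
    ∀ t ≤ N, c 0 = ∑ i ∈ Finset.range t, (-1 : ℝ) ^ i * D i + (-1) ^ t * c t := by
  intro t ht
  induction t with
  | zero => simp
  | succ t ih =>
    rw [ih (by omega), Finset.sum_range_succ, ← h t (by omega), pow_succ]
    ring

theorem sum_range_eq_sum_even_add_sum_odd (f : ℕ → ℝ) (r : ℕ) :
    ∑ i ∈ Finset.range r, f i =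
      ∑ j ∈ Finset.range ((r + 1) / 2), f (2 * j) + ∑ j ∈ Finset.range (r / 2), f (2 * j + 1) := by
  induction r with
  | zero => simp
  | succ r ih =>
    rw [Finset.sum_range_succ, ih]
    rcases Nat.even_or_odd' r with ⟨s, rfl | rfl⟩
    · rw [show (2 * s + 1 + 1) / 2 = s + 1 by omega, show (2 * s + 1) / 2 = s by omega,
        show 2 * s / 2 = s by omega, Finset.sum_range_succ]
      ring
    · rw [show (2 * s + 1 + 1 + 1) / 2 = s + 1 by omega, show (2 * s + 1 + 1) / 2 = s + 1 by omega,
        show (2 * s + 1) / 2 = s by omega,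
        Finset.sum_range_succ (fun j => f (2 * j + 1))]
      ring

theorem sum_triangle_comm (f : ℕ → ℕ → ℝ) (r : ℕ) :
    ∑ i ∈ Finset.range r, ∑ k ∈ Finset.range (r - 1 - i), f i k =
      ∑ k ∈ Finset.range r, ∑ i ∈ Finset.range (r - 1 - k), f i k :=
  Finset.sum_comm' (by intro i k; simp only [Finset.mem_range]; omega)

theorem sum_range_drop_zero {f : ℕ → ℝ} (h : f 0 = 0) (n : ℕ) :
    ∑ j ∈ Finset.range n, f j = ∑ j ∈ Finset.range (n - 1), f (j + 1) := by
  cases n with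
  | zero => simp
  | succ n => rw [Finset.sum_range_succ', h]; simp

/-- An alternating sum over a triangle of a symmetric array supported on even index sums reduces to
a sum over a square. -/
theorem sum_triangle_sub_sum_triangle {Q : ℕ → ℕ → ℝ} (hsymm : ∀ j n, Q j n = Q n j)
    (r : ℕ) (hodd : ∀ j n, j + n ≤ 2 * r → Odd (j + n) → Q j n = 0)
    (hzero : ∀ n, 1 ≤ n → n ≤ 2 * r + 1 → Q 0 n = 0) :
    ∑ i ∈ Finset.range r, (-1 : ℝ) ^ i *
        (∑ j ∈ Finset.range (2 * r - i), Q j (i + 1) - ∑ j ∈ Finset.range i, Q j (2 * r + 1 - i))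
      - (-1) ^ r * ∑ j ∈ Finset.range r, Q j (r + 1)
      = ∑ i ∈ Finset.range r, ∑ j ∈ Finset.range r, (-1 : ℝ) ^ i * Q (j + 1) (i + 1) := by
  -- Each row is cut after j = r: the first part, without its zero term j = 0, is a row of the
  -- square; the rest is a triangle.
  have h1 : ∀ i ∈ Finset.range r, ∑ j ∈ Finset.range (2 * r - i), Q j (i + 1) =
      ∑ j ∈ Finset.range r, Q (j + 1) (i + 1)
        + ∑ k ∈ Finset.range (r - 1 - i), Q (r + 1 + k) (i + 1) := by
    intro i hi
    rw [Finset.mem_range] at hi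
    rw [show 2 * r - i = (r + 1) + (r - 1 - i) by omega, Finset.sum_range_add,
      sum_range_drop_zero (hzero (i + 1) (by omega) (by omega)), Nat.add_sub_cancel]
  -- Transposed and reflected, the leftover triangle is exactly the one subtracted, whose last row i
  -- = r is the separate term (-1)^r ∑ Q j (r + 1).
  have h2 : ∑ i ∈ Finset.range r, (-1 : ℝ) ^ i * ∑ k ∈ Finset.range (r - 1 - i),
        Q (r + 1 + k) (i + 1) =
      ∑ i ∈ Finset.range (r + 1), (-1 : ℝ) ^ i * ∑ j ∈ Finset.range i, Q j (2 * r + 1 - i) := by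
    rw [← Finset.sum_range_reflect _ (r + 1), Finset.sum_range_succ]
    simp only [Finset.mul_sum]
    rw [sum_triangle_comm]
    have : ∑ i ∈ Finset.range (r + 1 - 1 - r), (-1 : ℝ) ^ (r + 1 - 1 - r) *
      Q i (2 * r + 1 - (r + 1 - 1 - r)) = 0 := by simp
    rw [this, add_zero]
    refine Finset.sum_congr rfl fun k hk => ?_
    rw [Finset.mem_range] at hk
    rw [sum_range_drop_zero (n := r + 1 - 1 - k) (by rw [hzero _ (by omega) (by omega), mul_zero]),
      show r + 1 - 1 - k - 1 = r - 1 - k by omega]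
    refine Finset.sum_congr rfl fun i hi => ?_
    rw [Finset.mem_range] at hi
    rw [show 2 * r + 1 - (r + 1 - 1 - k) = r + 1 + k by omega, hsymm (i + 1)]
    -- The signs (-1)^i and (-1)^(r-k) agree when the index sum is even; otherwise the entry
    -- vanishes.
    rcases Nat.even_or_odd (r + 1 + k + (i + 1)) with he | ho
    · congr 1
      rw [show r + 1 - 1 - k = r - k by omega]
      rcases Nat.even_or_odd i with hi' | hi'
      · rw [hi'.neg_one_pow, Even.neg_one_pow]
        grind
      · rw [hi'.neg_one_pow, Odd.neg_one_pow]
        grind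
    · rw [hodd _ _ (by omega) ho, mul_zero, mul_zero]
  have h3 := Finset.sum_range_succ
    (fun i => (-1 : ℝ) ^ i * ∑ j ∈ Finset.range i, Q j (2 * r + 1 - i)) r
  rw [show 2 * r + 1 - r = r + 1 by omega] at h3
  simp only [mul_sub, Finset.sum_sub_distrib]
  rw [Finset.sum_congr rfl fun i hi => by rw [h1 i hi]]
  simp only [mul_add, Finset.sum_add_distrib]
  rw [h2, h3]
  simp only [Finset.mul_sum]
  ring

/-- The decomposition of the even effective tensors, for correctors contracted with a fixed
direction: `u k` and `U k` stand for `χ^k` and `∇χ^k`, `X` for the multiplication by the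
direction. -/
theorem effective_decomposition {S F : Type*} [AddCommGroup S] [Module ℝ S] [AddCommGroup F]
    [Module ℝ F] (A : F →ₗ[ℝ] F →ₗ[ℝ] ℝ) (hA : ∀ V W, A V W = A W V)
    (M : S →ₗ[ℝ] S →ₗ[ℝ] ℝ) (hM : ∀ v w, M v w = M w v) (X : S →ₗ[ℝ] F)
    (u : ℕ → S) (U : ℕ → F) (p : ℕ → ℝ) (r : ℕ) (hodd : ∀ k, Odd k → p k = 0)
    (hzero : ∀ n, 1 ≤ n → n ≤ 2 * r + 1 → M (u 0) (u n) = 0)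
    (hfirst : ∀ n, 1 ≤ n → n ≤ 2 * r + 1 → A (U 1) (U n) = - A (X (u 0)) (U n))
    (hnext : ∀ m, m + 2 ≤ 2 * r + 1 → ∀ n, 1 ≤ n → n ≤ 2 * r + 1 →
      A (U (m + 2)) (U n) = - A (X (u (m + 1))) (U n) + A (U (m + 1) + X (u m)) (X (u n))
        - ∑ j ∈ Finset.range (m + 1), p (m - j) * M (u j) (u n)) :
    A (U (2 * r + 1) + X (u (2 * r))) (X (u 0)) =
      (-1) ^ r * (- A (U (r + 1)) (U (r + 1)) + A (X (u r)) (X (u r)))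
      + (∑ j ∈ Finset.range ((r + 1) / 2), ∑ l ∈ Finset.range ((r + 1) / 2),
          p (2 * (r + 1 - (j + 1) - (l + 1))) * M (u (2 * j + 1)) (u (2 * l + 1))
        - ∑ j ∈ Finset.range (r / 2), ∑ l ∈ Finset.range (r / 2),
          p (2 * (r - (j + 1) - (l + 1))) * M (u (2 * (j + 1))) (u (2 * (l + 1)))) := by
  -- With n = 2r + 1 - m, the order m - 1 - j of p in the cell problem is 2r - j - n, which is
  -- symmetric in j and n.
  set Q : ℕ → ℕ → ℝ := fun j n => p (2 * r - j - n) * M (u j) (u n) with hQ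
  have hQsymm : ∀ j n, Q j n = Q n j := fun j n => by
    simp only [hQ]; rw [hM, Nat.sub_right_comm]
  have hQodd : ∀ j n, j + n ≤ 2 * r → Odd (j + n) → Q j n = 0 := fun j n h ho => by
    simp only [hQ]; rw [hodd, zero_mul]; grind
  have hQzero : ∀ n, 1 ≤ n → n ≤ 2 * r + 1 → Q 0 n = 0 := fun n h1 h2 => by
    simp only [hQ]; rw [hzero n h1 h2, mul_zero]
  -- the fluxes
  set s : ℕ → F := fun m => match m with
    | 0 => 0
    | m + 1 => U (m + 1) + X (u m) with hs
  -- The convention s 0 = 0 lets the first cell problem share the form of the others.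
  have hflux : ∀ m, m ≤ 2 * r → ∀ n, n = 2 * r + 1 - m → A (s (m + 1)) (U n) =
      A (s m) (X (u n)) - ∑ j ∈ Finset.range m, Q j n := by
    intro m hm n hn
    cases m with
    | zero =>
      simp only [hs, map_add, LinearMap.add_apply, map_zero, LinearMap.zero_apply]
      rw [hfirst n (by omega) (by omega)]
      simp
    | succ m =>
      simp only [hs]
      rw [map_add, LinearMap.add_apply, hnext m (by omega) n (by omega) (by omega)]
      have : ∑ j ∈ Finset.range (m + 1), p (m - j) * M (u j) (u n) =
          ∑ j ∈ Finset.range (m + 1), Q j n := Finset.sum_congr rfl fun j hj => by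
        simp only [hQ]
        rw [show 2 * r - j - n = m - j by grind]
      rw [this]
      ring
  set b : ℕ → ℝ := fun m => A (s m) (X (u (2 * r + 1 - m))) with hb
  have hD : ∀ m, m ≤ 2 * r → A (s (m + 1)) (s (2 * r + 1 - m)) =
      b m + b (m + 1) - ∑ j ∈ Finset.range m, Q j (2 * r + 1 - m) := by
    intro m hm
    have h := hflux m hm _ rfl
    obtain ⟨n, hn⟩ : ∃ n, 2 * r + 1 - m = n + 1 := ⟨2 * r - m, by omega⟩
    simp only [hb]
    rw [show 2 * r + 1 - (m + 1) = n by omega]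
    rw [hn] at h ⊢
    conv_lhs => rw [show s (n + 1) = U (n + 1) + X (u n) from rfl]
    rw [map_add, h]
    ring
  set c : ℕ → ℝ := fun i => b (2 * r + 1 - i) - b i with hc
  have hrec : ∀ i < r, c (i + 1) + c i = ∑ j ∈ Finset.range (2 * r - i), Q j (i + 1)
      - ∑ j ∈ Finset.range i, Q j (2 * r + 1 - i) := by
    -- Both relations evaluate the same number, by symmetry of A.
    intro i hi
    have h1 := hD i (by omega)
    have h2 := hD (2 * r - i) (by omega)
    rw [show 2 * r + 1 - (2 * r - i) = i + 1 by omega,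
      show 2 * r - i + 1 = 2 * r + 1 - i by omega, hA] at h2
    simp only [hc]
    rw [show 2 * r + 1 - (i + 1) = 2 * r - i by omega]
    linarith
  have hcr : c r = (- A (U (r + 1)) (U (r + 1)) + A (X (u r)) (X (u r)))
      - ∑ j ∈ Finset.range r, Q j (r + 1) := by
    -- At the midpoint the test function is χ^{r+1} itself, so the mixed terms A(U_{r+1}, ξ u_r)
    -- cancel.
    have h := hflux r (by omega) (r + 1) (by omega)
    simp only [hc, hb]
    rw [show 2 * r + 1 - r = r + 1 by omega, show 2 * r + 1 - (r + 1) = r by omega]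
    have h' : A (s r) (X (u (r + 1))) =
      A (s (r + 1)) (U (r + 1)) + ∑ j ∈ Finset.range r, Q j (r + 1) := by linarith
    rw [h']
    simp only [hs, map_add, LinearMap.add_apply]
    rw [hA (X (u r)) (U (r + 1))]
    ring
  have hc0 : A (U (2 * r + 1) + X (u (2 * r))) (X (u 0)) = c 0 := by
    simp [hc, hb, hs]
  rw [hc0, eq_sum_alternating_add hrec r le_rfl, hcr, mul_sub]
  have hmain := sum_triangle_sub_sum_triangle hQsymm r hQodd hQzero
  have hsplit : ∑ i ∈ Finset.range r, ∑ j ∈ Finset.range r, (-1 : ℝ) ^ i * Q (j + 1) (i + 1) =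
      ∑ j ∈ Finset.range ((r + 1) / 2), ∑ l ∈ Finset.range ((r + 1) / 2),
          p (2 * (r + 1 - (j + 1) - (l + 1))) * M (u (2 * j + 1)) (u (2 * l + 1))
        - ∑ j ∈ Finset.range (r / 2), ∑ l ∈ Finset.range (r / 2),
          p (2 * (r - (j + 1) - (l + 1))) * M (u (2 * (j + 1))) (u (2 * (l + 1))) := by
    -- Even i means odd corrector order i + 1, hence sign +; mixed parities drop out.
    rw [sum_range_eq_sum_even_add_sum_odd, sub_eq_add_neg, ← Finset.sum_neg_distrib]
    congr 1
    · refine Finset.sum_congr rfl fun J hJ => ?_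
      rw [sum_range_eq_sum_even_add_sum_odd, Finset.sum_eq_zero (s := Finset.range (r / 2)),
        add_zero]
      · refine Finset.sum_congr rfl fun L hL => ?_
        rw [hQsymm]
        simp only [hQ]
        rw [Even.neg_one_pow ⟨J, by omega⟩, one_mul,
          show 2 * r - (2 * J + 1) - (2 * L + 1) = 2 * (r + 1 - (J + 1) - (L + 1)) by omega]
      · intro L hL
        rw [Finset.mem_range] at hJ hL
        rw [hQodd _ _ (by omega) ⟨L + J + 1, by omega⟩, mul_zero]
    · refine Finset.sum_congr rfl fun J hJ => ?_
      rw [sum_range_eq_sum_even_add_sum_odd, Finset.sum_eq_zero (s := Finset.range ((r + 1) / 2)),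
        zero_add, ← Finset.sum_neg_distrib]
      · refine Finset.sum_congr rfl fun L hL => ?_
        rw [hQsymm]
        simp only [hQ]
        rw [Odd.neg_one_pow ⟨J, rfl⟩, neg_one_mul,
          show 2 * r - (2 * J + 1 + 1) - (2 * L + 1 + 1) = 2 * (r - (J + 1) - (L + 1)) by omega,
          show 2 * J + 1 + 1 = 2 * (J + 1) by omega, show 2 * L + 1 + 1 = 2 * (L + 1) by omega]
      · intro L hL
        rw [Finset.mem_range] at hJ hL
        rw [hQodd _ _ (by omega) ⟨L + J + 1, by omega⟩, mul_zero]
  rw [← hsplit, ← hmain]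
  ring


/-! ### Bilinear forms on square-integrable functions and fields -/

/-- The square-integrable functions on the reference cell. -/
def l2Fun {d : ℕ} (ℓ : Fin d → ℝ) : Submodule ℝ ((Fin d → ℝ) → ℝ) where
  carrier := {u | MemLp u 2 (volume.restrict (cell ℓ))}
  add_mem' := fun hu hv => MemLp.add hu hv
  zero_mem' := MemLp.zero
  smul_mem' := fun c _ hu => MemLp.const_smul hu c

/-- The square-integrable vector fields on the reference cell. -/
def l2Field {d : ℕ} (ℓ : Fin d → ℝ) : Submodule ℝ ((Fin d → ℝ) → (Fin d → ℝ)) where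
  carrier := {V | ∀ i, MemLp (fun y => V y i) 2 (volume.restrict (cell ℓ))}
  add_mem' := fun hu hv i => MemLp.add (hu i) (hv i)
  zero_mem' := fun _ => MemLp.zero
  smul_mem' := fun c _ hu i => MemLp.const_smul (hu i) c

section

variable {d : ℕ} {ℓ : Fin d → ℝ} {a : (Fin d → ℝ) → Matrix (Fin d) (Fin d) ℝ}

/-- For i ≠ j, 4 A i j is the difference of the quadratic form at e_i + e_j and e_i - e_j, both
values lying in [0, 2C]. -/
theorem abs_entry_le_of_quadratic_bounds {A : Matrix (Fin d) (Fin d) ℝ} (hA : A.IsSymm) {C : ℝ}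
    (h0 : ∀ ξ : Fin d → ℝ, 0 ≤ (A *ᵥ ξ) ⬝ᵥ ξ)
    (hC : ∀ ξ : Fin d → ℝ, (A *ᵥ ξ) ⬝ᵥ ξ ≤ C * (ξ ⬝ᵥ ξ)) (i j : Fin d) : |A i j| ≤ C := by
  have hji : A j i = A i j := hA.apply i j
  have hi := hC (Pi.single i 1)
  have hi0 := h0 (Pi.single i 1)
  have hp := hC (Pi.single i 1 + Pi.single j 1)
  have hm := hC (Pi.single i 1 - Pi.single j 1)
  have hp0 := h0 (Pi.single i 1 + Pi.single j 1)
  have hm0 := h0 (Pi.single i 1 - Pi.single j 1)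
  simp [Matrix.mulVec_add, Matrix.mulVec_sub] at hi hi0 hp hm hp0 hm0
  rw [abs_le]
  rcases eq_or_ne i j with rfl | hij
  · constructor <;> linarith
  · simp [Pi.single_eq_of_ne hij, Pi.single_eq_of_ne hij.symm] at hp hm
    constructor <;> linarith

theorem IsCoefficient.memLp_top (ha : IsCoefficient ℓ a) (i j : Fin d) :
    MemLp (fun y => a y i j) ⊤ (volume.restrict (cell ℓ)) := by
  obtain ⟨lam, hlam, Lam, hLam, h⟩ := ha.elliptic
  refine memLp_top_of_bound (ha.aemeasurable i j).aestronglyMeasurable Lam ?_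
  filter_upwards [h, ha.isSymm] with y hy hs
  exact abs_entry_le_of_quadratic_bounds hs (fun ξ => (mul_nonneg hlam.le
    (Finset.sum_nonneg fun k _ => mul_self_nonneg (ξ k))).trans (hy ξ).1) (fun ξ => (hy ξ).2) i j

theorem IsCoefficient.integrable_mulVec_dotProduct (ha : IsCoefficient ℓ a) (V W : l2Field ℓ) :
    Integrable (fun y => (a y *ᵥ V.1 y) ⬝ᵥ W.1 y) (volume.restrict (cell ℓ)) := by
  simp only [Matrix.mulVec, dotProduct, Finset.sum_mul]
  refine integrable_finsetSum _ fun i _ => integrable_finsetSum _ fun j _ => ?_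
  have h1 : MemLp (fun y => a y i j * V.1 y j) 2 (volume.restrict (cell ℓ)) :=
    (V.2 j).mul' (ha.memLp_top i j)
  exact h1.integrable_mul (W.2 i)

/-- The form `⟨a V · W⟩_Y` on square-integrable vector fields. -/
noncomputable def IsCoefficient.form (ha : IsCoefficient ℓ a) :
    l2Field ℓ →ₗ[ℝ] l2Field ℓ →ₗ[ℝ] ℝ :=
  LinearMap.mk₂ ℝ (fun V W => ⨍ y in cell ℓ, (a y *ᵥ V.1 y) ⬝ᵥ W.1 y)
    (fun V₁ V₂ W => by
      simp only [average_eq, ← smul_add]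
      rw [← integral_add (ha.integrable_mulVec_dotProduct _ _)
        (ha.integrable_mulVec_dotProduct _ _)]
      simp [Matrix.mulVec_add, add_dotProduct])
    (fun c V W => by
      simp [average_eq, Matrix.mulVec_smul, smul_dotProduct, integral_const_mul, mul_left_comm])
    (fun V W₁ W₂ => by
      simp only [average_eq, ← smul_add]
      rw [← integral_add (ha.integrable_mulVec_dotProduct _ _)
        (ha.integrable_mulVec_dotProduct _ _)]
      simp [dotProduct_add])
    (fun c V W => by
      simp [average_eq, dotProduct_smul, integral_const_mul, mul_left_comm])

theorem IsCoefficient.form_apply (ha : IsCoefficient ℓ a) (V W : l2Field ℓ) :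
    ha.form V W = ⨍ y in cell ℓ, (a y *ᵥ V.1 y) ⬝ᵥ W.1 y := rfl

theorem IsCoefficient.form_comm (ha : IsCoefficient ℓ a) (V W : l2Field ℓ) :
    ha.form V W = ha.form W V := by
  rw [ha.form_apply, ha.form_apply, average_eq, average_eq]
  congr 1
  refine integral_congr_ae ?_
  filter_upwards [ha.isSymm] with y hy
  rw [dotProduct_comm, Matrix.dotProduct_mulVec, ← Matrix.mulVec_transpose, hy.eq]

/-- The form `⟨u w⟩_Y` on square-integrable functions. -/
noncomputable def meanForm (ℓ : Fin d → ℝ) : l2Fun ℓ →ₗ[ℝ] l2Fun ℓ →ₗ[ℝ] ℝ :=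
  have hint : ∀ u w : l2Fun ℓ, Integrable (fun y => u.1 y * w.1 y) (volume.restrict (cell ℓ)) :=
    fun u w => MemLp.integrable_mul u.2 w.2
  LinearMap.mk₂ ℝ (fun u w => ⨍ y in cell ℓ, u.1 y * w.1 y)
    (fun u₁ u₂ w => by
      simp only [average_eq, ← smul_add]
      rw [← integral_add (hint _ _) (hint _ _)]
      simp [add_mul])
    (fun c u w => by
      simp [average_eq, mul_assoc, integral_const_mul, mul_left_comm])
    (fun u w₁ w₂ => by
      simp only [average_eq, ← smul_add]
      rw [← integral_add (hint _ _) (hint _ _)]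
      simp [mul_add])
    (fun c u w => by
      simp [average_eq, mul_left_comm _ c, integral_const_mul])

theorem meanForm_apply (u w : l2Fun ℓ) :
    meanForm ℓ u w = ⨍ y in cell ℓ, u.1 y * w.1 y := rfl

theorem meanForm_comm (u w : l2Fun ℓ) : meanForm ℓ u w = meanForm ℓ w u := by
  simp only [meanForm_apply, mul_comm]

/-- The vector field `u v`, for a function `u` and a constant vector `v`. -/
def constMul (ℓ : Fin d → ℝ) : (Fin d → ℝ) →ₗ[ℝ] l2Fun ℓ →ₗ[ℝ] l2Field ℓ :=
  LinearMap.mk₂ ℝ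
    (fun v u => ⟨fun y => u.1 y • v, fun i => MemLp.mul_const u.2 (v i)⟩)
    (fun v₁ v₂ u => by ext; simp [mul_add])
    (fun c v u => by ext; simp [mul_left_comm])
    (fun v u₁ u₂ => by ext; simp [add_mul])
    (fun c v u => by ext; simp [mul_assoc])

theorem constMul_apply (v : Fin d → ℝ) (u : l2Fun ℓ) (y : Fin d → ℝ) :
    (constMul ℓ v u).1 y = u.1 y • v := rfl

/-- An element of `H¹_per(Y)` as a square-integrable function. -/
def PerH1.toL2 (u : PerH1 ℓ) : l2Fun ℓ := ⟨u.toFun, u.memLp⟩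

/-- The gradient of an element of `H¹_per(Y)` as a square-integrable vector field. -/
def PerH1.gradL2 (u : PerH1 ℓ) : l2Field ℓ := ⟨u.grad, u.grad_memLp⟩

end


/-! ### Contractions of the effective tensors and of the cell problems -/

section

variable {d : ℕ} {ℓ : Fin d → ℝ} {a : (Fin d → ℝ) → Matrix (Fin d) (Fin d) ℝ}

/-- The contraction of `χ^k` with a direction. -/
noncomputable def TensorFamily.contractVal (χ : TensorFamily ℓ) (ξ : Fin d → ℝ) (k : ℕ) : l2Fun ℓ :=
  contract ξ fun i => (χ k i).toL2

/-- The contraction of `∇χ^k` with a direction. -/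
noncomputable def TensorFamily.contractGrad (χ : TensorFamily ℓ) (ξ : Fin d → ℝ) (k : ℕ) :
    l2Field ℓ :=
  contract ξ fun i => (χ k i).gradL2

theorem contract_meanTriple {n : ℕ} (ξ : Fin d → ℝ) (q : Ten d n) (χ : TensorFamily ℓ) (j l : ℕ) :
    contract ξ (meanTriple q χ j l) =
      contract ξ q * meanForm ℓ (χ.contractVal ξ j) (χ.contractVal ξ l) := by
  have h : meanTriple q χ j l = fun i => meanForm ℓ
      (LinearMap.lsmul ℝ (l2Fun ℓ) (q fun t => i (Fin.castAdd l (Fin.castAdd j t)))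
        (χ j fun t => i (Fin.castAdd l (Fin.natAdd n t))).toL2)
      (χ l fun t => i (Fin.natAdd (n + j) t)).toL2 := by
    ext i
    rfl
  rw [h, contract_append ξ (meanForm ℓ)
    (fun i : Fin (n + j) → Fin d => LinearMap.lsmul ℝ (l2Fun ℓ) (q fun t => i (Fin.castAdd j t))
      (χ j fun t => i (Fin.natAdd n t)).toL2) (fun i => (χ l i).toL2),
    contract_append ξ (LinearMap.lsmul ℝ (l2Fun ℓ)) q fun i => (χ j i).toL2]
  simp [TensorFamily.contractVal]

theorem contract_hTensor (ξ : Fin d → ℝ) (G : (s : ℕ) → Ten d (2 * s + 2)) (χ : TensorFamily ℓ)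
    (r : ℕ) :
    contract ξ (hTensor G χ r) =
      ∑ j ∈ Finset.range ((r + 1) / 2), ∑ l ∈ Finset.range ((r + 1) / 2),
        contract ξ (G (r + 1 - (j + 1) - (l + 1))) *
          meanForm ℓ (χ.contractVal ξ (2 * j + 1)) (χ.contractVal ξ (2 * l + 1))
      - ∑ j ∈ Finset.range (r / 2), ∑ l ∈ Finset.range (r / 2),
        contract ξ (G (r - (j + 1) - (l + 1))) *
          meanForm ℓ (χ.contractVal ξ (2 * (j + 1))) (χ.contractVal ξ (2 * (l + 1))) := by
  refine (contract_sub ξ _ _).trans ?_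
  simp only [contract_finsetSum, Finset.sum_range]
  congr 1
  · refine Finset.sum_congr rfl fun j _ => Finset.sum_congr rfl fun l _ => ?_
    exact (contract_castTen ξ _ _).trans (contract_meanTriple ξ _ χ _ _)
  · refine Finset.sum_congr rfl fun j _ => Finset.sum_congr rfl fun l _ => ?_
    exact (contract_castTen ξ _ _).trans (contract_meanTriple ξ _ χ _ _)

theorem contract_hTensor_congr (ξ : Fin d → ℝ) {G G' : (s : ℕ) → Ten d (2 * s + 2)}
    (χ : TensorFamily ℓ) (r : ℕ) (h : ∀ s < r, contract ξ (G s) = contract ξ (G' s)) :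
    contract ξ (hTensor G χ r) = contract ξ (hTensor G' χ r) := by
  rw [contract_hTensor, contract_hTensor]
  congr 1
  · refine Finset.sum_congr rfl fun j hj => Finset.sum_congr rfl fun l hl => ?_
    rw [h _ (by grind)]
  · refine Finset.sum_congr rfl fun j hj => Finset.sum_congr rfl fun l hl => ?_
    rw [h _ (by grind)]

theorem contract_flux (ξ : Fin d → ℝ) (χ : TensorFamily ℓ) (m : ℕ) :
    contract ξ (fun i : Fin (m + 1) → Fin d => (χ (m + 1) i).gradL2
      + constMul ℓ (basisVec (i 0)) (χ m (Fin.tail i)).toL2) =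
      χ.contractGrad ξ (m + 1) + constMul ℓ ξ (χ.contractVal ξ m) := by
  rw [contract_add, contract_tail ξ (constMul ℓ) fun i => (χ m i).toL2]
  rfl

/-- The contraction of the mean flux against a scalar function. -/
theorem contract_form_flux (ha : IsCoefficient ℓ a) (ξ : Fin d → ℝ) (χ : TensorFamily ℓ) (m : ℕ)
    (w : l2Fun ℓ) :
    contract ξ (fun i : Fin (m + 2) → Fin d =>
      ha.form ((χ (m + 1) (Fin.tail i)).gradL2
        + constMul ℓ (basisVec (i 1)) (χ m (Fin.tail (Fin.tail i))).toL2)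
        (constMul ℓ (basisVec (i 0)) w)) =
      ha.form (χ.contractGrad ξ (m + 1) + constMul ℓ ξ (χ.contractVal ξ m)) (constMul ℓ ξ w) := by
  rw [← contract_flux]
  exact contract_tail ξ (ha.form.flip.comp ((constMul ℓ).flip w))
    fun i => (χ (m + 1) i).gradL2 + constMul ℓ (basisVec (i 0)) (χ m (Fin.tail i)).toL2

theorem contract_gTensor (ha : IsCoefficient ℓ a) (ξ : Fin d → ℝ) (χ : TensorFamily ℓ)
    (h0 : χ 0 = fun _ => PerH1.one ℓ) (m : ℕ) :
    contract ξ (gTensor a χ m) =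
      ha.form (χ.contractGrad ξ (m + 1) + constMul ℓ ξ (χ.contractVal ξ m))
        (constMul ℓ ξ (χ.contractVal ξ 0)) := by
  have h : χ.contractVal ξ 0 = (PerH1.one ℓ).toL2 := by
    rw [TensorFamily.contractVal, contract_zero_order, h0]
  rw [h, ← contract_form_flux]
  congr 1
  ext i
  rw [ha.form_apply]
  unfold gTensor
  congr 1
  ext y
  rw [constMul_apply]
  simp [PerH1.toL2, PerH1.one, PerH1.gradL2, constMul_apply]

theorem block_cons_cons {N s n : ℕ} (j k : Fin d) (i : Fin N → Fin d) (h : s + n ≤ N) :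
    block (Fin.cons j (Fin.cons k i : Fin (N + 1) → Fin d) : Fin (N + 2) → Fin d) (s + 2) n
      (by omega) = block i s n h := by
  ext t
  have ht : (⟨s + 2 + t, by have := t.isLt; omega⟩ : Fin (N + 2)) =
    Fin.succ (Fin.succ ⟨s + t, by have := t.isLt; omega⟩) := by
    ext
    simp
    omega
  simp only [block]
  rw [ht, Fin.cons_succ, Fin.cons_succ]

theorem contract_kTensor (ha : IsCoefficient ℓ a) (ξ : Fin d → ℝ) (χ : TensorFamily ℓ) (r : ℕ) :
    contract ξ (kTensor a χ r) =
      - ha.form (χ.contractGrad ξ (r + 1)) (χ.contractGrad ξ (r + 1))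
        + ha.form (constMul ℓ ξ (χ.contractVal ξ r)) (constMul ℓ ξ (χ.contractVal ξ r)) := by
  have h : kTensor a χ r = fun i =>
      - ha.form (χ (r + 1) (block i 0 (r + 1) (by omega))).gradL2
          (χ (r + 1) (block i (r + 1) (r + 1) (by omega))).gradL2
        + ha.form (constMul ℓ (basisVec (i ⟨1, by omega⟩)) (χ r (block i 2 r (by omega))).toL2)
          (constMul ℓ (basisVec (i ⟨0, by omega⟩)) (χ r (block i (r + 2) r (by omega))).toL2) :=
    rfl
  rw [h, contract_add, contract_neg, contract_block ξ (by omega) ha.form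
    (fun i => (χ (r + 1) i).gradL2) (fun i => (χ (r + 1) i).gradL2)]
  congr 1
  -- The vector e_{i_1} sits in the second slot and e_{i_2} in the first, so these two indices are
  -- summed separately before the two blocks of χ^r.
  rw [contract_succ]
  have hξ : constMul ℓ ξ (χ.contractVal ξ r) =
      ∑ j, ξ j • constMul ℓ (basisVec j) (χ.contractVal ξ r) :=
    map_eq_sum_basisVec ξ ((constMul ℓ).flip (χ.contractVal ξ r))
  rw [hξ]
  simp only [map_sum, map_smul]
  refine Finset.sum_congr rfl fun j _ => ?_
  congr 1
  rw [contract_succ, LinearMap.sum_apply]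
  refine Finset.sum_congr rfl fun k _ => ?_
  rw [LinearMap.smul_apply]
  congr 1
  have hB := contract_block ξ (two_mul r).symm
    (ha.form.compl₁₂ (constMul ℓ (basisVec k)) (constMul ℓ (basisVec j)))
    (fun i => (χ r i).toL2) (fun i => (χ r i).toL2)
  rw [LinearMap.compl₁₂_apply] at hB
  refine Eq.trans ?_ hB
  congr 1
  ext i
  rw [LinearMap.compl₁₂_apply, ← block_cons_cons j k i, ← block_cons_cons j k i]
  rfl

theorem PerH1.ZeroMean.meanForm_one_eq_zero {w : PerH1 ℓ} (hw : w.ZeroMean) :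
    meanForm ℓ (PerH1.one ℓ).toL2 w.toL2 = 0 := by
  rw [meanForm_apply, average_eq]
  have : ∫ y in cell ℓ, (PerH1.one ℓ).toL2.1 y * w.toL2.1 y = 0 := by
    simpa [PerH1.one, PerH1.toL2, PerH1.ZeroMean] using hw
  rw [this, smul_zero]

theorem IsCoefficient.form_gradL2 (ha : IsCoefficient ℓ a) (u w : PerH1 ℓ) :
    ha.form u.gradL2 w.gradL2 =
      ((volume.restrict (cell ℓ)).real Set.univ)⁻¹ * energy a u w := by
  rw [ha.form_apply, average_eq]
  rfl

/-- The factor |Y|⁻¹ converts the integrals of the cell problem into the averages used by `form` and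
`meanForm`. -/
theorem contract_cellRhs (ha : IsCoefficient ℓ a) (ξ : Fin d → ℝ) (p : (k : ℕ) → Ten d (k + 2))
    (χ : TensorFamily ℓ) (m : ℕ) (w : PerH1 ℓ) :
    ((volume.restrict (cell ℓ)).real Set.univ)⁻¹ * contract ξ (cellRhs a p χ m w) =
      - ha.form (constMul ℓ ξ (χ.contractVal ξ (m + 1))) w.gradL2
      + ha.form (χ.contractGrad ξ (m + 1) + constMul ℓ ξ (χ.contractVal ξ m)) (constMul ℓ ξ w.toL2)
      - ∑ j ∈ Finset.range (m + 1),
          contract ξ (p (m - j)) * meanForm ℓ (χ.contractVal ξ j) w.toL2 := by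
  set c := ((volume.restrict (cell ℓ)).real Set.univ)⁻¹ with hc
  have h : (fun i => c • cellRhs a p χ m w i) = fun i =>
      - ha.form.flip w.gradL2 (constMul ℓ (basisVec (i 0)) (χ (m + 1) (Fin.tail i)).toL2)
      + ha.form ((χ (m + 1) (Fin.tail i)).gradL2
          + constMul ℓ (basisVec (i 1)) (χ m (Fin.tail (Fin.tail i))).toL2)
          (constMul ℓ (basisVec (i 0)) w.toL2)
      - ∑ j : Fin (m + 1), castTen (n := m + 2) (by have := j.isLt; omega)
          (fun i : Fin (m - j + 2 + j) → Fin d =>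
            (LinearMap.mul ℝ ℝ).compl₂ ((meanForm ℓ).flip w.toL2) (p (m - j) fun t => i (Fin.castAdd j t))
            (χ j fun t => i (Fin.natAdd (m - j + 2) t)).toL2) i := by
    ext i
    unfold cellRhs
    rw [smul_sub, smul_add, smul_neg, Finset.smul_sum]
    congr 1
    · congr 1
      · rw [LinearMap.flip_apply, ha.form_apply, average_eq]
        rfl
      · rw [ha.form_apply, average_eq]
        rfl
    · refine Finset.sum_congr rfl fun j _ => ?_
      simp only [castTen, LinearMap.compl₂_apply, LinearMap.flip_apply, meanForm_apply, average_eq,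
        LinearMap.mul_apply', tmul, TensorFamily.val, mul_assoc]
      rw [integral_const_mul, smul_eq_mul, smul_eq_mul, ← mul_assoc, ← mul_assoc, mul_comm c]
      rfl
  rw [← smul_eq_mul, ← contract_smul, h, contract_sub, contract_add, contract_neg,
    contract_form_flux, map_contract, contract_sum,
    contract_tail ξ (constMul ℓ) fun i => (χ (m + 1) i).toL2, Finset.sum_range]
  congr 1
  refine Finset.sum_congr rfl fun j _ => ?_
  rw [contract_castTen, contract_append ξ _ (p (m - j)) fun i => (χ j i).toL2]
  rfl

end

/-! ### The contracted corrector equations and the decomposition -/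

section

variable {d : ℕ} {ℓ : Fin d → ℝ} {a : (Fin d → ℝ) → Matrix (Fin d) (Fin d) ℝ}
  {p : (k : ℕ) → Ten d (k + 2)} {χ : TensorFamily ℓ} {N : ℕ}

theorem IsCorrectors.mono (hχ : IsCorrectors a p χ N) {n : ℕ} (hn : n ≤ N) :
    IsCorrectors a p χ n where
  zero := hχ.zero
  zeroMean k h1 h2 := hχ.zeroMean k h1 (h2.trans hn)
  first h := hχ.first (h.trans hn)
  next m h := hχ.next m (h.trans hn)

theorem IsCorrectors.contractVal_zero (hχ : IsCorrectors a p χ N) (ξ : Fin d → ℝ) :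
    χ.contractVal ξ 0 = (PerH1.one ℓ).toL2 := by
  rw [TensorFamily.contractVal, contract_zero_order, hχ.zero]

theorem IsCorrectors.meanForm_contractVal (hχ : IsCorrectors a p χ N) (ξ : Fin d → ℝ) {n : ℕ}
    (h1 : 1 ≤ n) (h2 : n ≤ N) :
    meanForm ℓ (χ.contractVal ξ 0) (χ.contractVal ξ n) = 0 := by
  rw [hχ.contractVal_zero, TensorFamily.contractVal, ← map_contract]
  simp [(hχ.zeroMean n h1 h2 _).meanForm_one_eq_zero, contract]

theorem IsCorrectors.form_first (hχ : IsCorrectors a p χ N) (ha : IsCoefficient ℓ a)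
    (ξ : Fin d → ℝ) {n : ℕ} (h1 : 1 ≤ n) (h2 : n ≤ N) :
    ha.form (χ.contractGrad ξ 1) (χ.contractGrad ξ n) =
      - ha.form (constMul ℓ ξ (χ.contractVal ξ 0)) (χ.contractGrad ξ n) := by
  -- Only the solution side is contracted here; the test function stays a single element of
  -- W_per(Y), and linearity in it is used afterwards, component by component.
  have key : ∀ w : PerH1 ℓ, w.ZeroMean → ha.form (χ.contractGrad ξ 1) w.gradL2 =
      - ha.form (constMul ℓ ξ (χ.contractVal ξ 0)) w.gradL2 := by
    intro w hw
    have h : (fun i => ha.form.flip w.gradL2 (χ 1 i).gradL2) = fun i : Fin 1 → Fin d =>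
        - ha.form.flip w.gradL2 (constMul ℓ (basisVec (i 0)) (χ 0 (Fin.tail i)).toL2) := by
      ext i
      rw [LinearMap.flip_apply, ha.form_gradL2, hχ.first (h1.trans h2) i w hw, hχ.zero, mul_neg,
        LinearMap.flip_apply, ha.form_apply, average_eq]
      simp [constMul_apply, PerH1.toL2, PerH1.one, PerH1.gradL2]
    have h' := congrArg (contract ξ) h
    rw [contract_neg, map_contract, map_contract,
      contract_tail ξ (constMul ℓ) fun i => (χ 0 i).toL2] at h'
    exact h'
  conv_lhs => rw [TensorFamily.contractGrad.eq_def χ ξ n]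
  conv_rhs => rw [TensorFamily.contractGrad.eq_def χ ξ n]
  rw [← map_contract, ← map_contract, ← contract_neg]
  congr 1
  ext i
  exact key _ (hχ.zeroMean n h1 h2 i)

theorem IsCorrectors.form_next (hχ : IsCorrectors a p χ N) (ha : IsCoefficient ℓ a)
    (ξ : Fin d → ℝ) {m n : ℕ} (hm : m + 2 ≤ N) (h1 : 1 ≤ n) (h2 : n ≤ N) :
    ha.form (χ.contractGrad ξ (m + 2)) (χ.contractGrad ξ n) =
      - ha.form (constMul ℓ ξ (χ.contractVal ξ (m + 1))) (χ.contractGrad ξ n)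
      + ha.form (χ.contractGrad ξ (m + 1) + constMul ℓ ξ (χ.contractVal ξ m))
          (constMul ℓ ξ (χ.contractVal ξ n))
      - ∑ j ∈ Finset.range (m + 1),
          contract ξ (p (m - j)) * meanForm ℓ (χ.contractVal ξ j) (χ.contractVal ξ n) := by
  have key : ∀ w : PerH1 ℓ, w.ZeroMean → ha.form (χ.contractGrad ξ (m + 2)) w.gradL2 =
      - ha.form (constMul ℓ ξ (χ.contractVal ξ (m + 1))) w.gradL2
      + ha.form (χ.contractGrad ξ (m + 1) + constMul ℓ ξ (χ.contractVal ξ m)) (constMul ℓ ξ w.toL2)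
      - ∑ j ∈ Finset.range (m + 1),
          contract ξ (p (m - j)) * meanForm ℓ (χ.contractVal ξ j) w.toL2 := by
    intro w hw
    rw [← contract_cellRhs, ← contract_symmetrize, ← smul_eq_mul, ← contract_smul]
    have h : (fun i => ha.form.flip w.gradL2 (χ (m + 2) i).gradL2) = fun i =>
        ((volume.restrict (cell ℓ)).real Set.univ)⁻¹ • symmetrize (cellRhs a p χ m w) i := by
      ext i
      rw [LinearMap.flip_apply, ha.form_gradL2, hχ.next m hm i w hw, smul_eq_mul]
    rw [← h, map_contract]
    rfl
  have hn := congrArg (contract ξ) (funext fun i => key _ (hχ.zeroMean n h1 h2 i))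
  rw [contract_sub, contract_add, contract_neg, contract_sum, map_contract, map_contract] at hn
  refine hn.trans ?_
  congr 1
  · congr 1
    exact map_contract ξ ((ha.form _).comp (constMul ℓ ξ)) fun i => (χ n i).toL2
  · refine Finset.sum_congr rfl fun j _ => ?_
    exact map_contract ξ (contract ξ (p (m - j)) • meanForm ℓ (χ.contractVal ξ j))
      fun i => (χ n i).toL2

/-- The decomposition of `g^{2r}` up to symmetrization, when the correctors are computed with
tensors `p` that match the even `g`'s and vanish for odd orders. -/
theorem IsCorrectors.symEq_gTensor {r : ℕ} (hχ : IsCorrectors a p χ (2 * r + 1))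
    (ha : IsCoefficient ℓ a) (hodd : ∀ k, Odd k → p k = 0)
    (hp : ∀ s < r, SymEq (p (2 * s)) (gTensor a χ (2 * s))) :
    SymEq (gTensor a χ (2 * r))
      ((-1 : ℝ) ^ r • kTensor a χ r + hTensor (fun s => gTensor a χ (2 * s)) χ r) := by
  rw [symEq_iff_contract]
  intro ξ
  have hsum : contract ξ ((-1 : ℝ) ^ r • kTensor a χ r
      + hTensor (fun s => gTensor a χ (2 * s)) χ r) =
      (-1 : ℝ) ^ r • contract ξ (kTensor a χ r)
        + contract ξ (hTensor (fun s => gTensor a χ (2 * s)) χ r) := by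
    rw [← contract_smul, ← contract_add]
    rfl
  -- Only orders s < r enter h^r, so g may be exchanged for the p of the cell problems.
  rw [hsum, contract_hTensor_congr ξ χ r (G' := fun s => p (2 * s))
      fun s hs => ((symEq_iff_contract.mp (hp s hs)) ξ).symm,
    contract_hTensor, contract_gTensor ha ξ χ hχ.zero, contract_kTensor ha, smul_eq_mul]
  refine effective_decomposition ha.form ha.form_comm (meanForm ℓ) meanForm_comm (constMul ℓ ξ)
    (χ.contractVal ξ) (χ.contractGrad ξ) (fun k => contract ξ (p k)) r ?_ ?_ ?_ ?_
  · intro k hk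
    simp [hodd k hk, contract]
  · exact fun n h1 h2 => hχ.meanForm_contractVal ξ h1 h2
  · exact fun n h1 h2 => hχ.form_first ha ξ h1 h2
  · exact fun m hm n h1 h2 => hχ.form_next ha ξ hm h1 h2

end

/-! ### Dependence on the correctors and the recursive tensors -/

section

variable {d : ℕ} {ℓ : Fin d → ℝ} {a : (Fin d → ℝ) → Matrix (Fin d) (Fin d) ℝ}

theorem pTensor_odd (a0 : Ten d 2) (aT : (r : ℕ) → Ten d (2 * r + 2))
    (bT : (r : ℕ) → Ten d (2 * r)) {k : ℕ} (hk : Odd k) : pTensor a0 aT bT k = 0 :=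
  dif_neg (by grind)

theorem pTensor_zero (a0 : Ten d 2) (aT : (r : ℕ) → Ten d (2 * r + 2))
    (bT : (r : ℕ) → Ten d (2 * r)) : pTensor a0 aT bT 0 = a0 := by
  ext i
  simp [pTensor, cTensor, castTen]

theorem kTensor_congr {χ χ' : TensorFamily ℓ} {r : ℕ} (h : χ' r = χ r)
    (h' : χ' (r + 1) = χ (r + 1)) : kTensor a χ' r = kTensor a χ r := by
  unfold kTensor
  rw [h, h']

theorem meanTriple_congr {n : ℕ} (q : Ten d n) {χ χ' : TensorFamily ℓ} {j l : ℕ} (hj : χ' j = χ j)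
    (hl : χ' l = χ l) : meanTriple q χ' j l = meanTriple q χ j l := by
  unfold meanTriple TensorFamily.val
  rw [hj, hl]

theorem hTensor_congr {G G' : (s : ℕ) → Ten d (2 * s + 2)} {χ χ' : TensorFamily ℓ} {r : ℕ}
    (hG : ∀ s < r, G' s = G s) (hχ : ∀ k, 1 ≤ k → k ≤ r → χ' k = χ k) :
    hTensor G' χ' r = hTensor G χ r := by
  unfold hTensor
  congr 1
  · refine Finset.sum_congr rfl fun j _ => Finset.sum_congr rfl fun l _ => ?_
    rw [hG _ (by omega), meanTriple_congr _ (hχ _ (by omega) (by omega))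
      (hχ _ (by omega) (by omega))]
  · refine Finset.sum_congr rfl fun j _ => Finset.sum_congr rfl fun l _ => ?_
    rw [hG _ (by omega), meanTriple_congr _ (hχ _ (by omega) (by omega))
      (hχ _ (by omega) (by omega))]

/-- The guard s < r serves only the termination of the recursion: h^r never evaluates its argument
at s ≥ r. -/
theorem reducedTensor_eq (a : (Fin d → ℝ) → Matrix (Fin d) (Fin d) ℝ) (χ : TensorFamily ℓ) (r : ℕ) :
    reducedTensor a χ r =
      (-1 : ℝ) ^ r • kTensor a χ r + hTensor (reducedTensor a χ) χ r := by
  rw [reducedTensor]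
  congr 1
  exact hTensor_congr (fun s hs => if_pos hs) fun _ _ _ => rfl

theorem reducedTensor_congr {χ χ' : TensorFamily ℓ} (r : ℕ) (h : ∀ k ≤ r + 1, χ' k = χ k) :
    reducedTensor a χ' r = reducedTensor a χ r := by
  induction r using Nat.strong_induction_on with
  | _ r ih =>
    rw [reducedTensor_eq, reducedTensor_eq, kTensor_congr (h r (by omega)) (h _ le_rfl)]
    congr 1
    exact hTensor_congr (fun s hs => ih s hs fun k hk => h k (by omega))
      fun k _ hk => h k (by omega)

/-- Equality up to symmetrization passes through h^s, because contraction is multiplicative; strong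
induction on s then suffices. -/
theorem symEq_gTensor_reducedTensor {χ : TensorFamily ℓ} {r : ℕ}
    (h : ∀ s ≤ r, SymEq (gTensor a χ (2 * s))
      ((-1 : ℝ) ^ s • kTensor a χ s + hTensor (fun s => gTensor a χ (2 * s)) χ s)) :
    ∀ s ≤ r, SymEq (gTensor a χ (2 * s)) (reducedTensor a χ s) := by
  intro s hs
  induction s using Nat.strong_induction_on with
  | _ s ih =>
    rw [symEq_iff_contract]
    intro ξ
    rw [symEq_iff_contract.mp (h s hs) ξ, reducedTensor_eq]
    refine (contract_add ξ _ _).trans ((congrArg _ ?_).trans (contract_add ξ _ _).symm)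
    exact contract_hTensor_congr ξ χ s fun t ht =>
      symEq_iff_contract.mp (ih t ht (by omega)) ξ

end

end HighOrderWave

open HighOrderWave

theorem theorem3p3 {d : ℕ} (ℓ : Fin d → ℝ) (hℓ : ∀ i, 0 < ℓ i)
    (a : (Fin d → ℝ) → Matrix (Fin d) (Fin d) ℝ) (ha : IsCoefficient ℓ a)
    (r : ℕ) (hr : 1 ≤ r)
    (aT : (s : ℕ) → Ten d (2 * s + 2)) (bT : (s : ℕ) → Ten d (2 * s))
    (χ : TensorFamily ℓ)
    (hχ : IsCorrectors a (pTensor (gTensor a χ 0) aT bT) χ (2 * r + 1))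
    (hp : ∀ s, 1 ≤ s → s < r →
      SymEq (pTensor (gTensor a χ 0) aT bT (2 * s)) (gTensor a χ (2 * s))) :
    -- the decomposition
    SymEq (gTensor a χ (2 * r))
      ((-1 : ℝ) ^ r • kTensor a χ r + hTensor (fun s => gTensor a χ (2 * s)) χ r) ∧
    -- `k^r` is built from `χ^r` and `χ^{r+1}` only
    (∀ χ' : TensorFamily ℓ, χ' r = χ r → χ' (r + 1) = χ (r + 1) →
      kTensor a χ' r = kTensor a χ r) ∧
    -- `h^r` is built from `g^0, …, g^{2(r-1)}` and `χ^1, …, χ^r` only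
    (∀ (G : (s : ℕ) → Ten d (2 * s + 2)) (χ' : TensorFamily ℓ),
      (∀ s, s < r → G s = gTensor a χ (2 * s)) → (∀ k, 1 ≤ k → k ≤ r → χ' k = χ k) →
      hTensor G χ' r = hTensor (fun s => gTensor a χ (2 * s)) χ r) ∧
    -- up to symmetrization, `h^r` can be computed from `χ^1, …, χ^r` (and `χ^0 = 1`)
    SymEq (hTensor (fun s => gTensor a χ (2 * s)) χ r) (hTensor (reducedTensor a χ) χ r) ∧
    (∀ χ' : TensorFamily ℓ, (∀ k, k ≤ r → χ' k = χ k) →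
      hTensor (reducedTensor a χ') χ' r = hTensor (reducedTensor a χ) χ r) ∧
    -- `S(g^{2r})` can be computed from `χ^1, …, χ^{r+1}` (and `χ^0 = 1`)
    symmetrize (gTensor a χ (2 * r)) = symmetrize (reducedTensor a χ r) ∧
    (∀ χ' : TensorFamily ℓ, (∀ k, k ≤ r + 1 → χ' k = χ k) →
      reducedTensor a χ' r = reducedTensor a χ r) := by
  have hp' : ∀ s < r, SymEq (pTensor (gTensor a χ 0) aT bT (2 * s)) (gTensor a χ (2 * s)) := by
    intro s hs
    -- For s = 0 the constraint holds by construction, as p^0 = c^0 = g^0.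
    rcases Nat.eq_zero_or_pos s with rfl | h
    · rw [Nat.mul_zero, pTensor_zero]
      rfl
    · exact hp s h hs
  -- The recursion needs the decomposition at every order s ≤ r; the correctors up to 2s + 1 and the
  -- constraints below s are among those given.
  have hdec : ∀ s ≤ r, SymEq (gTensor a χ (2 * s))
      ((-1 : ℝ) ^ s • kTensor a χ s + hTensor (fun s => gTensor a χ (2 * s)) χ s) :=
    fun s hs => (hχ.mono (by omega)).symEq_gTensor ha (fun _ => pTensor_odd _ _ _)
      fun t ht => hp' t (by omega)
  have hred := symEq_gTensor_reducedTensor hdec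
  refine ⟨hdec r le_rfl, fun χ' => kTensor_congr, fun G χ' hG => hTensor_congr hG, ?_, ?_,
    hred r le_rfl, fun χ' => reducedTensor_congr r⟩
  · exact symEq_iff_contract.mpr fun ξ => contract_hTensor_congr ξ χ r fun s hs =>
      symEq_iff_contract.mp (hred s hs.le) ξ
  · exact fun χ' h => hTensor_congr
      (fun s hs => reducedTensor_congr s fun k hk => h k (by omega)) fun k _ hk => h k hk
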